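/- \textbf{Setting.} Let $h:\mathbb R^n\to(-\infty,\infty]$ be proper, lower semicontinuous and convex, let $A\in\mathbb R^{m\times n}$ and $b\in\mathbb R^m$, and assume that $\{x\in\mathbb R^n: Ax=b\}\neq\emptyset$. Consider the problem $$\text{(P)}\quad \text{minimize } h(x)\ \text{ subject to } Ax=b ,$$ where a solution of (P) is a point $\bar x$ with $A\bar x=b$, $h(\bar x)<\infty$ and $h(\bar x)\le h(x)$ for all $x$ with $Ax=b$. For $\lambda>0$ put $$\ell(x,y)=h(x)+\langle y,Ax-b\rangle,\qquad \mathcal L_\lambda(x,y)=\ell(x,y)+\tfrac{\lambda}{2}\|Ax-b\|^2,\qquad d(y)=\inf_{x\in\mathbb R^n}\ell(x,y)\in[-\infty,\infty),$$ and let (D) be the dual problem: maximize $d(y)$ over $y\in\mathbb R^m$. Put $g=-d$ and let $e_\lambda g(y)=\inf_{w\in\mathbb R^m}\{g(w)+\frac1{2\lambda}\|w-y\|^2\}$ be its Moreau envelope. \textbf{Algorithm GIALM.} Choose $y^1\in\mathbb R^m$, $\lambda>0$, $\varepsilon_1>0$, $\theta\in(0,1)$, $\mu>2$. For $k=1,2,\dots$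 find $x^{k+1}\in\mathbb R^n$ and the smallest $i_k\in\{0,1,2,\dots\}$ such that $$\mathcal L_\lambda(x^{k+1},y^k)-\inf_{x\in\mathbb R^n}\mathcal L_\lambda(x,y^k)\le\frac{\lambda\theta^{2i_k}\varepsilon_k^2}{2}\qquad\text{and}\qquad \|b-Ax^{k+1}\|>\mu\,\theta^{i_k}\varepsilon_k ,$$ and set $y^{k+1}=y^k+\lambda(Ax^{k+1}-b)$, $\varepsilon_{k+1}=\theta^{i_k}\varepsilon_k$. Here ``smallest'' is meant in the sense of the following search: $i=0,1,2,\dots$ are tried in turn, for each $i$ some point satisfying the first inequality with $i$ in place of $i_k$ is computed, and the search stops, with $i_k=i$ and $x^{k+1}$ this point, as soon as this point also satisfies the second inequality. \textbf{KL property.} A differentiable $f:\mathbb R^m\to\mathbb R$ satisfies the KL property at $\bar y$ with the function $\psi$ if there are $\eta>0$ and a neighborhood $U$ of $\bar y$ such that $\psi:(0,\eta)\to(0,\infty)$ is nondecreasing, $1/\psi$ is integrable over $(0,\eta)$, and $\|\nabla f(y)\|\ge\psi(f(y)-f(\bar y))$ for all $y\in U$ with $f(\bar y)<f(y)<f(\bar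 y)+\eta$. It satisfies the KL property at $\bar y$ if it does so with some $\psi$. (Under the assumption $\sup d>-\infty$ below, $e_\lambda g$ is real-valued and differentiable.) \textbf{Theorem.} Let $\{x^k\}$ and $\{y^k\}$ be generated by GIALM. Assume that $\sup_{y\in\mathbb R^m}d(y)>-\infty$ and that no $y^k$, $k\ge1$, is a solution of (D). Then either $\|y^k\|\to\infty$ as $k\to\infty$, or all of the following hold. (i) Every accumulation point of $\{y^k\}$ is a solution of (D). If, in addition, $\{y^k\}$ is bounded, then every accumulation point of $\{x^k\}$ is a solution of (P). (ii) If $e_\lambda g$ satisfies the KL property at an accumulation point $\bar y$ of $\{y^k\}$, then $y^k\to\bar y$ as $k\to\infty$. (iii) If $e_\lambda g$ satisfies the KL property at an accumulation point $\bar y$ of $\{y^k\}$ with $\psi(t)=Mt^q$ for some $M>0$ and $q\in(0,1)$, then: $\bullet$ if $q\in(0,1/2]$, the sequence $\{y^k\}$ converges linearly to $\bar y$, i.e. there are $c>0$ and $r\in(0,1)$ with $\|y^k-\bar y\|\le c\,r^k$ for all $k\ge1$; $\bullet$ if $q\in(1/2,1)$, then $\|y^k-\bar y\|=\mathcal O\big(k^{-\frac{1-q}{2q-1}}\big)$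 as $k\to\infty$. -/

import Mathlib

open Filter Topology Set Asymptotics

noncomputable section

namespace GIALM

/-- `A x` as a vector of the Euclidean space `ℝᵐ`. -/
def mulE {m n : ℕ} (A : Matrix (Fin m) (Fin n) ℝ) (x : EuclideanSpace ℝ (Fin n)) :
    EuclideanSpace ℝ (Fin m) :=
  WithLp.toLp 2 (A.mulVec x.ofLp)

/-- `h` takes values in `(-∞, ∞]` and is finite somewhere. -/
def Proper {E : Type*} (h : E → EReal) : Prop :=
  (∀ x, h x ≠ ⊥) ∧ ∃ x, h x ≠ ⊤

/-- Convexity of a function with values in `(-∞, ∞]`. -/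
def ConvexFun {E : Type*} [AddCommGroup E] [Module ℝ E] (h : E → EReal) : Prop :=
  ∀ x y : E, ∀ s t : ℝ, 0 < s → 0 < t → s + t = 1 →
    h (s • x + t • y) ≤ (s : EReal) * h x + (t : EReal) * h y

section Problem

variable {m n : ℕ} (h : EuclideanSpace ℝ (Fin n) → EReal) (A : Matrix (Fin m) (Fin n) ℝ)
  (b : EuclideanSpace ℝ (Fin m))

/-- The Lagrange function `ℓ(x, y) = h(x) + ⟨y, A x - b⟩`. -/
def lagrangian (x : EuclideanSpace ℝ (Fin n)) (y : EuclideanSpace ℝ (Fin m)) : EReal :=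
  h x + ((inner ℝ y (mulE A x - b) : ℝ) : EReal)

/-- The augmented Lagrangian `ℓ(x, y) + (λ / 2) ‖A x - b‖²`. -/
def augLagrangian (lam : ℝ) (x : EuclideanSpace ℝ (Fin n)) (y : EuclideanSpace ℝ (Fin m)) :
    EReal :=
  lagrangian h A b x y + ((lam / 2 * ‖mulE A x - b‖ ^ 2 : ℝ) : EReal)

/-- The dual Lagrange function `d(y) = inf_x ℓ(x, y)`. -/
def dual (y : EuclideanSpace ℝ (Fin m)) : EReal :=
  ⨅ x : EuclideanSpace ℝ (Fin n), lagrangian h A b x y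

/-- `y` maximizes the dual function. -/
def IsDualSolution (y : EuclideanSpace ℝ (Fin m)) : Prop :=
  ∀ w : EuclideanSpace ℝ (Fin m), dual h A b w ≤ dual h A b y

/-- `x` minimizes `h` subject to `A x = b` (with a finite optimal value). -/
def IsPrimalSolution (x : EuclideanSpace ℝ (Fin n)) : Prop :=
  mulE A x = b ∧ h x ≠ ⊤ ∧
    ∀ z : EuclideanSpace ℝ (Fin n), mulE A z = b → h x ≤ h z

/-- The first (accuracy) test of Step 1, for the trial point `x` at the point `y`, with the trial
error `θ ^ i * ε`. -/
def AccuracyTest (lam θ ε : ℝ) (i : ℕ) (x : EuclideanSpace ℝ (Fin n))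
    (y : EuclideanSpace ℝ (Fin m)) : Prop :=
  augLagrangian h A b lam x y - (⨅ z : EuclideanSpace ℝ (Fin n), augLagrangian h A b lam z y)
    ≤ ((lam * θ ^ (2 * i) * ε ^ 2 / 2 : ℝ) : EReal)

/-- The second (residual) test of Step 1, with the trial error `θ ^ i * ε`. -/
def ResidualTest (θ μ ε : ℝ) (i : ℕ) (x : EuclideanSpace ℝ (Fin n)) : Prop :=
  μ * (θ ^ i * ε) < ‖b - mulE A x‖

/-- The sequences `x ^ k` (`k ≥ 2`), `y ^ k`, `ε_k`, `i_k` (`k ≥ 1`) are generated by the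
gradient-based inexact augmented Lagrangian method with proximal parameter `lam`, error reduction
factor `θ` and scaling factor `μ`. The iteration counter starts at `1`, the exponents `i_k` at `0`;
the entries of the sequences at smaller indices play no role.

The search of Step 1 tries `i = 0, 1, 2, …`; for each `i` it computes a point that passes the
accuracy test, and it stops at the first `i` for which this point passes the residual test too.
So `i_k` is the smallest exponent in the sense of `search`: for each smaller exponent `j` the trial
point, which passed the accuracy test, failed the residual test. (The other readings of "smallest",
namely minimality of `i_k` for the given `x ^ (k + 1)` or over all points, imply `search`.) -/
structure IsGenerated (lam θ μ : ℝ) (x : ℕ → EuclideanSpace ℝ (Fin n))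
    (y : ℕ → EuclideanSpace ℝ (Fin m)) (ε : ℕ → ℝ) (i : ℕ → ℕ) : Prop where
  lam_pos : 0 < lam
  theta_mem : θ ∈ Ioo (0 : ℝ) 1
  two_lt_mu : 2 < μ
  eps_one_pos : 0 < ε 1
  accuracy : ∀ k, 1 ≤ k → AccuracyTest h A b lam θ (ε k) (i k) (x (k + 1)) (y k)
  residual : ∀ k, 1 ≤ k → ResidualTest A b θ μ (ε k) (i k) (x (k + 1))
  search : ∀ k, 1 ≤ k → ∀ j, j < i k →
    ∃ z, AccuracyTest h A b lam θ (ε k) j z (y k) ∧ ¬ ResidualTest A b θ μ (ε k) j z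
  y_update : ∀ k, 1 ≤ k → y (k + 1) = y k + lam • (mulE A (x (k + 1)) - b)
  eps_update : ∀ k, 1 ≤ k → ε (k + 1) = θ ^ (i k) * ε k

end Problem

/-- The Moreau envelope `e_λ g (x) = inf_w {g(w) + ‖w - x‖² / (2 λ)}` as a real function (the
infimum is finite when `g` is proper, lower semicontinuous and convex and `λ > 0`). -/
def moreau {E : Type*} [NormedAddCommGroup E] (lam : ℝ) (g : E → EReal) (x : E) : ℝ :=
  (⨅ w : E, g w + ((1 / (2 * lam) * ‖w - x‖ ^ 2 : ℝ) : EReal)).toReal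

/-- The Kurdyka-Łojasiewicz property of `f` at `a` with the function `ψ`. -/
def KLWith {E : Type*} [NormedAddCommGroup E] [InnerProductSpace ℝ E] [CompleteSpace E]
    (f : E → ℝ) (a : E) (ψ : ℝ → ℝ) : Prop :=
  ∃ η : ℝ, 0 < η ∧ ∃ U ∈ 𝓝 a,
    (∀ t ∈ Ioo 0 η, 0 < ψ t) ∧ MonotoneOn ψ (Ioo 0 η) ∧
    MeasureTheory.IntegrableOn (fun t => 1 / ψ t) (Ioo 0 η) ∧
    ∀ x ∈ U, f a < f x → f x < f a + η → ψ (f x - f a) ≤ ‖gradient f x‖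

/-- The Kurdyka-Łojasiewicz property of `f` at `a`. -/
def KL {E : Type*} [NormedAddCommGroup E] [InnerProductSpace ℝ E] [CompleteSpace E]
    (f : E → ℝ) (a : E) : Prop :=
  ∃ ψ : ℝ → ℝ, KLWith f a ψ

/-- Linear (geometric) convergence of a sequence. -/
def ConvergesLinearly {E : Type*} [NormedAddCommGroup E] (u : ℕ → E) (l : E) : Prop :=
  ∃ c : ℝ, 0 < c ∧ ∃ r ∈ Ioo (0 : ℝ) 1, ∀ k, 1 ≤ k → ‖u k - l‖ ≤ c * r ^ k

end GIALM

end

/-! The method is inexact gradient descent on the Moreau envelope of `g`. Over the convex set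
`valueEpi` of pairs (residual, upper bound on `h`), the augmented Lagrangian is strongly convex in
the residual. So although its infimum `D y` need not be attained, the residuals of minimizing
sequences converge to one vector `u y` (`exists_isAugMin`). The point `y + lam • u y` attains the
infimum defining the Moreau envelope. Hence `-D` is that envelope (`IsAugMin.moreau_eq`), `D` is
concave, and the gradient of `-D` is `-u` (`hasGradientAt_neg_of_isAugMin`).

The accuracy test places the computed residual within `ε (k + 1)` of `u (y k)`, and the residual
test makes this error less than a fraction `1 / μ < 1 / 2` of the residual itself. Each step
therefore decreases `-D` by a multiple of its squared length and dominates the gradient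
(`IsGenerated.isDescent`). From there the usual KL argument gives convergence
(`IsDescent.exists_norm_sub_le`), and a scalar recursion for the gaps in value gives the rates
(`IsDescent.rates`).

Optimality of accumulation points needs no KL property: steps, and with them gradients and
residuals, tend to zero; concavity of `D` and lower semicontinuity of `h` do the rest. -/

namespace GIALM

/-! ### Augmented minimization over a convex set, and the smooth concave function it defines -/

section ConvexSet

variable {F : Type*} [NormedAddCommGroup F] [InnerProductSpace ℝ F]

/-- The augmented Lagrangian as a function of a point `(u, a)` of the epigraph of the value
function. -/
noncomputable def augValue (lam : ℝ) (y : F) (p : F × ℝ) : ℝ :=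
  p.2 + inner ℝ y p.1 + lam / 2 * ‖p.1‖ ^ 2

/-- Only the squared norm fails to be affine, so the defect of convexity is exact. This is strong
convexity in the first component. -/
lemma augValue_convexCombo (lam : ℝ) (y : F) (p q : F × ℝ) (s t : ℝ) (hst : s + t = 1) :
    augValue lam y (s • p + t • q) =
      s * augValue lam y p + t * augValue lam y q - lam / 2 * (s * t) * ‖p.1 - q.1‖ ^ 2 := by
  obtain rfl : s = 1 - t := by linarith
  simp only [augValue, Prod.fst_add, Prod.snd_add, Prod.smul_fst, Prod.smul_snd, inner_add_right,
    inner_smul_right, smul_eq_mul, norm_sub_sq_real, norm_add_sq_real, norm_smul, mul_pow,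
    Real.norm_eq_abs, sq_abs, inner_smul_left, conj_trivial]
  ring

/-- Completing the square: the left side, as a function of `w`, is maximal at `w = y + lam • p.1`,
where equality holds. -/
lemma augValue_ge (lam : ℝ) (hl : 0 < lam) (y w : F) (p : F × ℝ) :
    p.2 + inner ℝ w p.1 - 1 / (2 * lam) * ‖w - y‖ ^ 2 ≤ augValue lam y p := by
  have h : 0 ≤ 1 / (2 * lam) * ‖(w - y) - lam • p.1‖ ^ 2 := by positivity
  have e : 1 / (2 * lam) * ‖(w - y) - lam • p.1‖ ^ 2 = 1 / (2 * lam) * ‖w - y‖ ^ 2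
      - (inner ℝ w p.1 - inner ℝ y p.1) + lam / 2 * ‖p.1‖ ^ 2 := by
    rw [norm_sub_sq_real, norm_smul, inner_smul_right, inner_sub_left, mul_pow, Real.norm_eq_abs,
      sq_abs]
    field_simp
  unfold augValue
  linarith

/-- `D` is the infimum of the augmented Lagrangian at `y`, and `u` is the residual of its
(generalized) minimizer. -/
structure IsAugMin (C : Set (F × ℝ)) (lam : ℝ) (y : F) (D : ℝ) (u : F) : Prop where
  le : ∀ p ∈ C, D + lam / 2 * ‖u‖ ^ 2 ≤ p.2 + inner ℝ (y + lam • u) p.1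
  approx : ∀ η, 0 < η → ∃ p ∈ C, augValue lam y p < D + η

/-- `C` need not be closed, so `u` is obtained as a limit of first components of a minimizing
sequence; the second components need not be followed separately. -/
lemma exists_isAugMin [CompleteSpace F] {C : Set (F × ℝ)} (hC : Convex ℝ C) (hne : C.Nonempty)
    {lam : ℝ} (hl : 0 < lam) {w : F} {c : ℝ} (hw : ∀ p ∈ C, c ≤ p.2 + inner ℝ w p.1) (y : F) :
    ∃ D u, IsAugMin C lam y D u := by
  have hbdd : BddBelow (augValue lam y '' C) := by
    refine ⟨c - 1 / (2 * lam) * ‖w - y‖ ^ 2, ?_⟩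
    rintro _ ⟨p, hp, rfl⟩
    linarith [augValue_ge lam hl y w p, hw p hp]
  set D := sInf (augValue lam y '' C) with hD
  have hDle : ∀ p ∈ C, D ≤ augValue lam y p := fun p hp => csInf_le hbdd ⟨p, hp, rfl⟩
  have happrox : ∀ η, 0 < η → ∃ p ∈ C, augValue lam y p < D + η := by
    intro η hη
    obtain ⟨_, ⟨p, hp, rfl⟩, h⟩ := exists_lt_of_csInf_lt (hne.image (augValue lam y))
      (show sInf (augValue lam y '' C) < D + η by linarith)
    exact ⟨p, hp, h⟩
  choose p hpC hp using fun j : ℕ => happrox (1 / ((j : ℝ) + 1)) Nat.one_div_pos_of_nat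
  have hlim : Tendsto (fun j : ℕ => 1 / ((j : ℝ) + 1)) atTop (𝓝 0) :=
    tendsto_one_div_add_atTop_nhds_zero_nat
  -- The midpoint of two nearly optimal points has value at least `D`, so strong convexity forces
  -- their first components together.
  have hcauchy : CauchySeq fun j => (p j).1 := by
    refine cauchySeq_of_le_tendsto_0 (fun N : ℕ => √(8 / lam * (1 / ((N : ℝ) + 1)))) ?_ ?_
    · intro j k N hj hk
      have hm := hDle _ (hC (hpC j) (hpC k) (by norm_num : (0 : ℝ) ≤ 1 / 2)
        (by norm_num : (0 : ℝ) ≤ 1 / 2) (by norm_num))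
      rw [augValue_convexCombo _ _ _ _ _ _ (by norm_num)] at hm
      have h1 := Nat.one_div_le_one_div (α := ℝ) hj
      have h2 := Nat.one_div_le_one_div (α := ℝ) hk
      have h3 : lam / 8 * ‖(p j).1 - (p k).1‖ ^ 2 ≤ 1 / ((N : ℝ) + 1) := by
        linarith [hp j, hp k]
      rw [dist_eq_norm]
      apply Real.le_sqrt_of_sq_le
      calc _ = 8 / lam * (lam / 8 * ‖(p j).1 - (p k).1‖ ^ 2) := by field_simp
        _ ≤ _ := by gcongr
    · have := (hlim.const_mul (8 / lam)).sqrt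
      simpa using this
  obtain ⟨u, hu⟩ := cauchySeq_tendsto_of_complete hcauchy
  refine ⟨D, u, ⟨fun q hq => ?_, happrox⟩⟩
  have hA : Tendsto (fun j => augValue lam y (p j)) atTop (𝓝 D) := by
    refine tendsto_of_tendsto_of_tendsto_of_le_of_le tendsto_const_nhds
      (by simpa using hlim.const_add D) (fun j => hDle _ (hpC j)) fun j => (hp j).le
  -- First-order optimality at a point that may not exist: move from `p j` towards `q`, let `j → ∞`,
  -- and divide by `t`. Letting `t → 0` then gives the sharp constant.
  have hstep : ∀ t : ℝ, 0 < t → t < 1 →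
      D ≤ augValue lam y q - lam / 2 * (1 - t) * ‖u - q.1‖ ^ 2 := by
    intro t ht ht1
    have hj : ∀ j, D ≤ (1 - t) * augValue lam y (p j) + t * augValue lam y q
        - lam / 2 * ((1 - t) * t) * ‖(p j).1 - q.1‖ ^ 2 := fun j => by
      rw [← augValue_convexCombo _ _ _ _ _ _ (by ring)]
      exact hDle _ (hC (hpC j) hq (by linarith) ht.le (by ring))
    have hl' := ge_of_tendsto' (((hA.const_mul (1 - t)).add_const (t * augValue lam y q)).sub
      (((hu.sub_const q.1).norm.pow 2).const_mul (lam / 2 * ((1 - t) * t)))) hj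
    have : 0 ≤ t * (augValue lam y q - lam / 2 * (1 - t) * ‖u - q.1‖ ^ 2 - D) := by
      linarith
    linarith [nonneg_of_mul_nonneg_right this ht]
  have hlimt : Tendsto (fun t : ℝ => augValue lam y q - lam / 2 * (1 - t) * ‖u - q.1‖ ^ 2)
      (𝓝[>] 0) (𝓝 (augValue lam y q - lam / 2 * (1 - 0) * ‖u - q.1‖ ^ 2)) :=
    (Continuous.tendsto (by fun_prop) 0).mono_left nhdsWithin_le_nhds
  have hfin := ge_of_tendsto hlimt (by
    filter_upwards [Ioo_mem_nhdsGT (zero_lt_one' ℝ)] with t ht using hstep t ht.1 ht.2)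
  rw [norm_sub_sq_real] at hfin
  rw [inner_add_left, inner_smul_left, conj_trivial]
  unfold augValue at hfin
  linarith

namespace IsAugMin

variable {C : Set (F × ℝ)} {lam : ℝ} {y : F} {D : ℝ} {u : F}

lemma add_sq_le (h : IsAugMin C lam y D u) {p : F × ℝ} (hp : p ∈ C) :
    D + lam / 2 * ‖p.1 - u‖ ^ 2 ≤ augValue lam y p := by
  have := h.le p hp
  rw [inner_add_left, inner_smul_left, conj_trivial] at this
  rw [norm_sub_sq_real, real_inner_comm]
  unfold augValue
  linarith

lemma le_augValue (h : IsAugMin C lam y D u) (hl : 0 < lam) {p : F × ℝ} (hp : p ∈ C) :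
    D ≤ augValue lam y p := by
  have : 0 ≤ lam / 2 * ‖p.1 - u‖ ^ 2 := by positivity
  linarith [h.add_sq_le hp]

/-- Concavity of the augmented dual function. -/
lemma le_add_inner (h : IsAugMin C lam y D u) (hl : 0 < lam) {z : F} {D' : ℝ} {u' : F}
    (h' : IsAugMin C lam z D' u') : D' ≤ D + inner ℝ u (z - y) := by
  choose p hpC hp using fun j : ℕ => h.approx (1 / ((j : ℝ) + 1)) Nat.one_div_pos_of_nat
  have hlim : Tendsto (fun j : ℕ => 1 / ((j : ℝ) + 1)) atTop (𝓝 0) :=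
    tendsto_one_div_add_atTop_nhds_zero_nat
  have hu : Tendsto (fun j => (p j).1) atTop (𝓝 u) := by
    rw [tendsto_iff_norm_sub_tendsto_zero]
    refine squeeze_zero (fun _ => norm_nonneg _)
      (g := fun j : ℕ => √(2 / lam * (1 / ((j : ℝ) + 1)))) (fun j => ?_)
      (by simpa using (hlim.const_mul (2 / lam)).sqrt)
    have h3 : lam / 2 * ‖(p j).1 - u‖ ^ 2 ≤ 1 / ((j : ℝ) + 1) := by
      linarith [hp j, h.add_sq_le (hpC j)]
    apply Real.le_sqrt_of_sq_le
    calc _ = 2 / lam * (lam / 2 * ‖(p j).1 - u‖ ^ 2) := by field_simp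
      _ ≤ _ := by gcongr
  -- For fixed `p`, `augValue` is affine in its dual argument with slope `p.1`; a minimizing
  -- sequence at `y` is tested at `z`.
  refine ge_of_tendsto' (x := atTop) (f := fun j : ℕ => D + 1 / ((j : ℝ) + 1) + inner ℝ (p j).1 (z - y)) ?_
    fun j => ?_
  · simpa using (hlim.const_add D).add (hu.inner tendsto_const_nhds)
  · have h1 := h'.le_augValue hl (hpC j)
    have h2 := hp j
    unfold augValue at h1 h2
    rw [real_inner_comm, inner_sub_left]
    linarith

/-- The augmented dual function is bounded below by a quadratic. -/
lemma add_inner_le (h : IsAugMin C lam y D u) (hl : 0 < lam) {z : F} {D' : ℝ} {u' : F}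
    (h' : IsAugMin C lam z D' u') :
    D + inner ℝ u (z - y) - 1 / (2 * lam) * ‖z - y‖ ^ 2 ≤ D' := by
  refine le_of_forall_pos_le_add fun η hη => ?_
  obtain ⟨p, hp, hlt⟩ := h'.approx η hη
  have h1 := h.le p hp
  -- The proximal point of `y` serves as a trial dual point at `z`.
  have h2 := augValue_ge lam hl z (y + lam • u) p
  have e : 1 / (2 * lam) * ‖(y + lam • u) - z‖ ^ 2 =
      lam / 2 * ‖u‖ ^ 2 - inner ℝ u (z - y) + 1 / (2 * lam) * ‖z - y‖ ^ 2 := by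
    rw [show (y + lam • u) - z = lam • u - (z - y) by abel, norm_sub_sq_real, norm_smul,
      inner_smul_left, mul_pow, Real.norm_eq_abs, sq_abs, conj_trivial]
    field_simp
  linarith

end IsAugMin

/-- The augmented dual function is differentiable, with the residual as its gradient. -/
lemma hasGradientAt_neg_of_isAugMin [CompleteSpace F] {C : Set (F × ℝ)} {lam : ℝ} (hl : 0 < lam)
    {D : F → ℝ} {u : F → F} (h : ∀ y, IsAugMin C lam y (D y) (u y)) (y : F) :
    HasGradientAt (fun z => -D z) (-u y) y := by
  rw [hasGradientAt_iff_isLittleO]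
  have hO : (fun z => -D z - -D y - inner ℝ (-u y) (z - y)) =O[𝓝 y] fun z => ‖z - y‖ ^ 2 := by
    refine IsBigO.of_bound (1 / (2 * lam)) (Eventually.of_forall fun z => ?_)
    have h1 := (h y).le_add_inner hl (h z)
    have h2 := (h y).add_inner_le hl (h z)
    rw [inner_neg_left, Real.norm_eq_abs, Real.norm_of_nonneg (by positivity), abs_le]
    have : 0 ≤ 1 / (2 * lam) * ‖z - y‖ ^ 2 := by positivity
    constructor <;> linarith
  refine hO.trans_isLittleO ?_
  have hz : Tendsto (fun z : F => z - y) (𝓝 y) (𝓝 0) := by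
    simpa using (continuous_id.sub continuous_const).tendsto (f := fun z : F => z - y) y
  exact (isLittleO_norm_pow_id (one_lt_two)).comp_tendsto hz

end ConvexSet

/-! ### Translation between the extended-real problem and its value epigraph -/

section EReal

variable {m n : ℕ} {h : EuclideanSpace ℝ (Fin n) → EReal} {A : Matrix (Fin m) (Fin n) ℝ}
  {b : EuclideanSpace ℝ (Fin m)}

/-- Comparing infima only with real lower bounds, over the epigraph of `h`, removes the case of
infinite values once and for all. -/
lemma coe_le_iInf_add_coe {E : Type*} {h : E → EReal} (hb : ∀ x, h x ≠ ⊥) (q : E → ℝ) (c : ℝ) :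
    (c : EReal) ≤ ⨅ z, h z + (q z : EReal) ↔ ∀ z (a : ℝ), h z ≤ a → c ≤ a + q z := by
  rw [le_iInf_iff]
  refine forall_congr' fun z => ?_
  have hz := hb z
  induction hv : h z with
  | bot => exact absurd hv hz
  | top => simp
  | coe v =>
    constructor
    · intro hc a ha
      have hc' : c ≤ v + q z := by exact_mod_cast hc
      have ha' : v ≤ a := by exact_mod_cast ha
      linarith
    · intro H
      exact_mod_cast H v le_rfl

variable (h A b) in
/-- The image of the epigraph of `h` under `(x, a) ↦ (A x - b, a)`. -/
def valueEpi : Set (EuclideanSpace ℝ (Fin m) × ℝ) :=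
  {p | ∃ x, mulE A x - b = p.1 ∧ h x ≤ (p.2 : EReal)}

lemma mulE_combo (x z : EuclideanSpace ℝ (Fin n)) (s t : ℝ) :
    mulE A (s • x + t • z) = s • mulE A x + t • mulE A z := by
  ext j
  simp [mulE, Matrix.mulVec_add, Matrix.mulVec_smul]

lemma continuous_mulE : Continuous (mulE A) := by
  unfold mulE
  fun_prop

lemma convex_valueEpi (hc : ConvexFun h) : Convex ℝ (valueEpi h A b) := by
  rw [convex_iff_forall_pos]
  rintro ⟨u, a⟩ ⟨x, rfl, hx⟩ ⟨v, c⟩ ⟨z, rfl, hz⟩ s t hs ht hst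
  refine ⟨s • x + t • z, ?_, (hc x z s t hs ht hst).trans ?_⟩
  · simp only [mulE_combo, Prod.fst_add, Prod.smul_fst, smul_sub]
    have : b = s • b + t • b := by rw [← add_smul, hst, one_smul]
    nth_rewrite 1 [this]
    abel
  · simp only [Prod.snd_add, Prod.smul_snd, smul_eq_mul, EReal.coe_add, EReal.coe_mul] at hx hz ⊢
    gcongr

lemma coe_le_dual (hb : ∀ x, h x ≠ ⊥) (w : EuclideanSpace ℝ (Fin m)) (c : ℝ) :
    (c : EReal) ≤ dual h A b w ↔ ∀ p ∈ valueEpi h A b, c ≤ p.2 + inner ℝ w p.1 := by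
  unfold dual lagrangian
  rw [coe_le_iInf_add_coe hb]
  constructor
  · rintro H ⟨u, a⟩ ⟨x, rfl, hx⟩
    exact H x a hx
  · intro H x a hx
    exact H (_, a) ⟨x, rfl, hx⟩

lemma augLagrangian_eq (lam : ℝ) (x : EuclideanSpace ℝ (Fin n)) (y : EuclideanSpace ℝ (Fin m)) :
    augLagrangian h A b lam x y = h x +
      ((inner ℝ y (mulE A x - b) + lam / 2 * ‖mulE A x - b‖ ^ 2 : ℝ) : EReal) := by
  rw [augLagrangian, lagrangian, add_assoc, ← EReal.coe_add]

lemma coe_le_iInf_augLagrangian (hb : ∀ x, h x ≠ ⊥) (lam : ℝ) (y : EuclideanSpace ℝ (Fin m))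
    (c : ℝ) : (c : EReal) ≤ ⨅ z, augLagrangian h A b lam z y ↔
      ∀ p ∈ valueEpi h A b, c ≤ augValue lam y p := by
  simp_rw [augLagrangian_eq]
  rw [coe_le_iInf_add_coe hb]
  unfold augValue
  constructor
  · rintro H ⟨u, a⟩ ⟨x, rfl, hx⟩
    rw [add_assoc]
    exact H x a hx
  · intro H x a hx
    rw [← add_assoc]
    exact H (_, a) ⟨x, rfl, hx⟩

variable {lam : ℝ} {y : EuclideanSpace ℝ (Fin m)} {D : ℝ} {u : EuclideanSpace ℝ (Fin m)}

lemma le_of_forall_coe_le {v : EReal} {r : ℝ} (H : ∀ c : ℝ, (c : EReal) ≤ v → c ≤ r) :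
    v ≤ r := by
  by_contra! hlt
  obtain ⟨c, h1, h2⟩ := EReal.lt_iff_exists_real_btwn.1 hlt
  exact absurd (H c h2.le) (not_le.2 (by exact_mod_cast h1))

lemma IsAugMin.iInf_augLagrangian (hb : ∀ x, h x ≠ ⊥) (hl : 0 < lam)
    (hm : IsAugMin (valueEpi h A b) lam y D u) : ⨅ z, augLagrangian h A b lam z y = D := by
  apply le_antisymm
  · refine le_of_forall_coe_le fun c hc => le_of_forall_pos_le_add fun η hη => ?_
    obtain ⟨p, hp, hlt⟩ := hm.approx η hη
    exact ((coe_le_iInf_augLagrangian hb lam y c).1 hc p hp).trans hlt.le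
  · exact (coe_le_iInf_augLagrangian hb lam y D).2 fun p hp => hm.le_augValue hl hp

lemma IsAugMin.le_dual (hb : ∀ x, h x ≠ ⊥) (hm : IsAugMin (valueEpi h A b) lam y D u) :
    ((D + lam / 2 * ‖u‖ ^ 2 : ℝ) : EReal) ≤ dual h A b (y + lam • u) :=
  (coe_le_dual hb _ _).2 hm.le

lemma IsAugMin.dual_le (hb : ∀ x, h x ≠ ⊥) (hl : 0 < lam)
    (hm : IsAugMin (valueEpi h A b) lam y D u) (w : EuclideanSpace ℝ (Fin m)) :
    dual h A b w ≤ ((D + 1 / (2 * lam) * ‖w - y‖ ^ 2 : ℝ) : EReal) := by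
  refine le_of_forall_coe_le fun c hc => le_of_forall_pos_le_add fun η hη => ?_
  obtain ⟨p, hp, hlt⟩ := hm.approx η hη
  linarith [(coe_le_dual hb w c).1 hc p hp, augValue_ge lam hl y w p]

/-- `dual_le` bounds every term of the infimum below by `-D`, and `le_dual` shows that `y + lam • u`
attains this bound. -/
lemma IsAugMin.moreau_eq (hb : ∀ x, h x ≠ ⊥) (hl : 0 < lam)
    (hm : IsAugMin (valueEpi h A b) lam y D u) :
    moreau lam (fun w => -dual h A b w) y = -D := by
  have : (⨅ w, -dual h A b w + ((1 / (2 * lam) * ‖w - y‖ ^ 2 : ℝ) : EReal)) =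
      ((-D : ℝ) : EReal) := by
    apply le_antisymm
    · refine (iInf_le _ (y + lam • u)).trans ?_
      refine (add_le_add_left (EReal.neg_le_neg_iff.2 (hm.le_dual hb)) _).trans ?_
      rw [← EReal.coe_neg, ← EReal.coe_add, EReal.coe_le_coe_iff, add_sub_cancel_left, norm_smul,
        mul_pow, Real.norm_eq_abs, sq_abs]
      apply le_of_eq
      field_simp
      ring
    · refine le_iInf fun w => ?_
      refine le_trans ?_ (add_le_add_left (EReal.neg_le_neg_iff.2 (hm.dual_le hb hl w)) _)
      rw [← EReal.coe_neg, ← EReal.coe_add, EReal.coe_le_coe_iff]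
      linarith
  rw [moreau, this, EReal.toReal_coe]

/-- Since `dual ≤ D` pointwise, `D yb` bounds the dual function. The proximal point of `yb` has dual
value at least `D yb + lam / 2 * ‖u yb‖ ^ 2`, which forces `u yb = 0`; so `yb` is its own proximal
point and attains the bound. -/
lemma isDualSolution_of_forall_le (hb : ∀ x, h x ≠ ⊥) (hl : 0 < lam)
    {D : EuclideanSpace ℝ (Fin m) → ℝ} {u : EuclideanSpace ℝ (Fin m) → EuclideanSpace ℝ (Fin m)}
    (hm : ∀ y, IsAugMin (valueEpi h A b) lam y (D y) (u y)) {yb : EuclideanSpace ℝ (Fin m)}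
    (hmax : ∀ z, D z ≤ D yb) : IsDualSolution h A b yb := by
  have hle : ∀ w, dual h A b w ≤ (D yb : EReal) := fun w => by
    have := (hm w).dual_le hb hl w
    rw [sub_self, norm_zero] at this
    refine this.trans (EReal.coe_le_coe_iff.2 ?_)
    linarith [hmax w]
  have h1 : D yb + lam / 2 * ‖u yb‖ ^ 2 ≤ D yb := by
    exact_mod_cast ((hm yb).le_dual hb).trans (hle _)
  have hu : u yb = 0 := by
    by_contra hne
    have : 0 < lam / 2 * ‖u yb‖ ^ 2 := by
      have := norm_pos_iff.2 hne
      positivity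
    linarith
  have h2 := (hm yb).le_dual hb
  rw [hu, smul_zero, add_zero, norm_zero] at h2
  intro w
  refine (hle w).trans (le_trans ?_ h2)
  rw [EReal.coe_le_coe_iff]
  linarith

/-- A point that passes the accuracy test. -/
lemma IsAugMin.of_accuracyTest (hb : ∀ x, h x ≠ ⊥) (hl : 0 < lam)
    (hm : IsAugMin (valueEpi h A b) lam y D u) {θ ε : ℝ} {i : ℕ} {x : EuclideanSpace ℝ (Fin n)}
    (ht : AccuracyTest h A b lam θ ε i x y) :
    ∃ a : ℝ, h x = a ∧
      augValue lam y (mulE A x - b, a) ≤ D + lam / 2 * (θ ^ i * ε) ^ 2 := by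
  rw [AccuracyTest, hm.iInf_augLagrangian hb hl, augLagrangian_eq] at ht
  have hx := hb x
  induction hv : h x with
  | bot => exact absurd hv hx
  | top =>
    rw [hv, EReal.top_add_coe, EReal.top_sub_coe, top_le_iff] at ht
    exact absurd ht (EReal.coe_ne_top _)
  | coe a =>
    refine ⟨a, rfl, ?_⟩
    rw [hv] at ht
    have ht' : a + (inner ℝ y (mulE A x - b) + lam / 2 * ‖mulE A x - b‖ ^ 2) - D ≤
      lam * θ ^ (2 * i) * ε ^ 2 / 2 := by exact_mod_cast ht
    have e : lam / 2 * (θ ^ i * ε) ^ 2 = lam * θ ^ (2 * i) * ε ^ 2 / 2 := by ring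
    unfold augValue
    linarith

end EReal

end GIALM

namespace GIALM

/-! ### The desingularizing function -/

section Desingularization

open MeasureTheory

variable {ψ : ℝ → ℝ} {η : ℝ}

/-- The desingularizing function of `ψ`. -/
noncomputable def desing (ψ : ℝ → ℝ) (t : ℝ) : ℝ := ∫ s in (0 : ℝ)..t, 1 / ψ s

lemma intervalIntegrable_one_div (hint : IntegrableOn (fun t => 1 / ψ t) (Ioo 0 η)) {s t : ℝ}
    (hs : 0 ≤ s) (hst : s ≤ t) (ht : t < η) :
    IntervalIntegrable (fun t => 1 / ψ t) volume s t := by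
  rw [intervalIntegrable_iff_integrableOn_Ioc_of_le hst]
  exact hint.mono_set fun r hr => ⟨hs.trans_lt hr.1, hr.2.trans_lt ht⟩

/-- As `ψ` is nondecreasing, the integrand is at least `1 / ψ t` on `[s, t]`. This replaces the
concavity inequality, with no differentiability needed. -/
lemma div_le_desing_sub (hpos : ∀ t ∈ Ioo 0 η, 0 < ψ t) (hmono : MonotoneOn ψ (Ioo 0 η))
    (hint : IntegrableOn (fun t => 1 / ψ t) (Ioo 0 η)) {s t : ℝ} (hs : 0 < s) (hst : s ≤ t)
    (ht : t < η) : (t - s) / ψ t ≤ desing ψ t - desing ψ s := by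
  have e : desing ψ t - desing ψ s = ∫ r in s..t, 1 / ψ r :=
    intervalIntegral.integral_interval_sub_left
      (intervalIntegrable_one_div hint le_rfl (hs.le.trans hst) ht)
      (intervalIntegrable_one_div hint le_rfl hs.le (hst.trans_lt ht))
  have hc : ∫ _ in s..t, 1 / ψ t = (t - s) / ψ t := by
    rw [intervalIntegral.integral_const, smul_eq_mul, mul_one_div]
  rw [e, ← hc]
  refine intervalIntegral.integral_mono_on hst (by simp)
    (intervalIntegrable_one_div hint hs.le hst ht) fun r hr => ?_
  have hr' : r ∈ Ioo 0 η := ⟨hs.trans_le hr.1, hr.2.trans_lt ht⟩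
  exact one_div_le_one_div_of_le (hpos r hr')
    (hmono hr' ⟨hs.trans_le hst, ht⟩ hr.2)

lemma desing_nonneg (hpos : ∀ t ∈ Ioo 0 η, 0 < ψ t) {t : ℝ} (h0 : 0 ≤ t) (ht : t < η) :
    0 ≤ desing ψ t := by
  unfold desing
  rw [intervalIntegral.integral_of_le h0]
  exact setIntegral_nonneg measurableSet_Ioc fun r hr =>
    (one_div_pos.2 (hpos r ⟨hr.1, hr.2.trans_lt ht⟩)).le

lemma tendsto_desing (hη : 0 < η) (hint : IntegrableOn (fun t => 1 / ψ t) (Ioo 0 η)) :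
    Tendsto (desing ψ) (𝓝[>] 0) (𝓝 0) := by
  have hi : IntegrableOn (fun t => 1 / ψ t) (Icc 0 (η / 2)) := by
    rw [integrableOn_Icc_iff_integrableOn_Ioc]
    exact hint.mono_set fun r hr => ⟨hr.1, by linarith [hr.2]⟩
  have hc := intervalIntegral.continuousOn_primitive_interval (a := 0) (b := η / 2)
    (μ := volume) (f := fun t => 1 / ψ t) (by rwa [uIcc_of_le (by linarith)])
  rw [uIcc_of_le (by linarith)] at hc
  have h0 := hc 0 ⟨le_rfl, by linarith⟩
  have h0' : Tendsto (desing ψ) (𝓝[Icc 0 (η / 2)] 0) (𝓝 (desing ψ 0)) := h0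
  have : desing ψ 0 = 0 := by simp [desing]
  rw [this] at h0'
  refine h0'.mono_left ?_
  rw [← nhdsWithin_Ioc_eq_nhdsGT (show (0 : ℝ) < η / 2 by linarith)]
  exact nhdsWithin_mono _ Ioc_subset_Icc_self

lemma desing_rpow {M q : ℝ} (hq : q < 1) {t : ℝ} (ht : 0 ≤ t) :
    desing (fun s => M * s ^ q) t = 1 / (M * (1 - q)) * t ^ (1 - q) := by
  unfold desing
  have : ∫ s in (0 : ℝ)..t, 1 / (M * s ^ q) = ∫ s in (0 : ℝ)..t, 1 / M * s ^ (-q) := by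
    refine intervalIntegral.integral_congr fun s hs => ?_
    rw [uIcc_of_le ht] at hs
    rw [Real.rpow_neg hs.1, one_div, one_div, mul_inv]
  rw [this, intervalIntegral.integral_const_mul, integral_rpow (Or.inl (by linarith)),
    Real.zero_rpow (by linarith), sub_zero, show -q + 1 = 1 - q by ring, one_div, one_div, mul_inv,
    mul_assoc]
  congr 1
  rw [div_eq_inv_mul]

end Desingularization

/-! ### Scalar recursions behind the rates -/

section Recursion

lemma geometric_of_recursion {r : ℕ → ℝ} {β q : ℝ} {K : ℕ} (hβ : 0 < β) (hq : q ≤ 1 / 2)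
    (hpos : ∀ k, K ≤ k → 0 < r k) (hle : ∀ k, K ≤ k → r k ≤ 1)
    (hrec : ∀ k, K ≤ k → β * r k ^ (2 * q) ≤ r k - r (k + 1)) :
    ∃ ρ ∈ Ioo (0 : ℝ) 1, ∀ j, r (K + j) ≤ ρ ^ j := by
  have hstep : ∀ k, K ≤ k → r (k + 1) ≤ (1 - β) * r k := fun k hk => by
    have h1 : r k ≤ r k ^ (2 * q) := by
      conv_lhs => rw [← Real.rpow_one (r k)]
      exact Real.rpow_le_rpow_of_exponent_ge (hpos k hk) (hle k hk) (by linarith)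
    nlinarith [hrec k hk]
  -- The next term is still positive, so the contraction factor must be.
  have hβ1 : 0 < 1 - β := by
    have := hstep K le_rfl
    have h2 := hpos (K + 1) (by omega)
    exact pos_of_mul_pos_left (h2.trans_le this) (hpos K le_rfl).le
  refine ⟨1 - β, ⟨hβ1, by linarith⟩, fun j => ?_⟩
  induction j with
  | zero => simpa using hle K le_rfl
  | succ j ih =>
    calc r (K + (j + 1)) ≤ (1 - β) * r (K + j) := hstep (K + j) (Nat.le_add_right K j)
      _ ≤ (1 - β) * (1 - β) ^ j := by gcongr
      _ = _ := by ring

/-- Discrete form of: `r' ≤ -β r ^ (p + 1)` implies `(r ^ (-p))' ≥ p β`. Bernoulli's inequality for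
the exponent `p ≤ 1` replaces the derivative. -/
lemma rpow_neg_add_le {p β r t : ℝ} (hp : 0 < p) (hp1 : p ≤ 1) (hr : 0 < r) (ht : 0 < t)
    (h : β * r ^ (p + 1) ≤ r - t) : r ^ (-p) + p * β ≤ t ^ (-p) := by
  have hb : (t / r) ^ p ≤ 1 + p * (t / r - 1) := by
    have := rpow_one_add_le_one_add_mul_self (s := t / r - 1) (p := p)
      (by linarith [div_pos ht hr]) hp.le hp1
    rwa [add_sub_cancel] at this
  have h1 : 0 < (t / r) ^ p := Real.rpow_pos_of_pos (div_pos ht hr) _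
  have hrp : 0 < r ^ p := Real.rpow_pos_of_pos hr _
  have h2 : 1 - p * (t / r - 1) ≤ (t / r) ^ (-p) := by
    rw [Real.rpow_neg (div_pos ht hr).le, ← one_div, le_div_iff₀ h1]
    rcases le_or_gt (1 - p * (t / r - 1)) 0 with h0 | h0
    · exact (mul_nonpos_of_nonpos_of_nonneg h0 h1.le).trans zero_le_one
    · calc _ ≤ (1 - p * (t / r - 1)) * (1 + p * (t / r - 1)) := by gcongr
        _ ≤ 1 := by nlinarith [sq_nonneg (p * (t / r - 1))]
  have h3 : β * r ^ p ≤ 1 - t / r := by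
    rw [Real.rpow_add_one hr.ne'] at h
    rw [one_sub_div hr.ne', le_div_iff₀ hr]
    linarith
  have h4 : t ^ (-p) = r ^ (-p) * (t / r) ^ (-p) := by
    rw [← Real.mul_rpow hr.le (div_pos ht hr).le, mul_div_cancel₀ _ hr.ne']
  have h5 : r ^ (-p) * r ^ p = 1 := by rw [← Real.rpow_add hr]; simp
  have hrn : 0 < r ^ (-p) := Real.rpow_pos_of_pos hr _
  rw [h4]
  calc r ^ (-p) + p * β = r ^ (-p) * (1 + p * (β * r ^ p)) := by
        linear_combination (-(p * β)) * h5
    _ ≤ r ^ (-p) * (1 - p * (t / r - 1)) := by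
        gcongr
        nlinarith
    _ ≤ _ := by gcongr

lemma sublinear_of_recursion {r : ℕ → ℝ} {β q : ℝ} {K : ℕ} (hβ : 0 < β) (hq : 1 / 2 < q)
    (hq1 : q < 1) (hpos : ∀ k, K ≤ k → 0 < r k)
    (hrec : ∀ k, K ≤ k → β * r k ^ (2 * q) ≤ r k - r (k + 1)) :
    (fun k => r k ^ (1 - q)) =O[atTop] fun k : ℕ => (k : ℝ) ^ (-((1 - q) / (2 * q - 1))) := by
  set p := 2 * q - 1 with hp
  have hp0 : 0 < p := by linarith
  have hlin : ∀ j : ℕ, p * β * j ≤ r (K + j) ^ (-p) := fun j => by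
    induction j with
    | zero => simpa using (Real.rpow_pos_of_pos (hpos K le_rfl) _).le
    | succ j ih =>
      have hK1 : K ≤ K + j + 1 := by omega
      have := rpow_neg_add_le (β := β) hp0 (by linarith) (hpos (K + j) (Nat.le_add_right K j))
        (hpos (K + j + 1) hK1) (by
          rw [show p + 1 = 2 * q by rw [hp]; ring]
          exact hrec (K + j) (by omega))
      push_cast
      rw [← add_assoc]
      linarith
  refine IsBigO.of_bound ((p * β / 2) ^ (-((1 - q) / p))) ?_
  -- Beyond `2 * K` the shift by `K` costs only a factor `2`; the extra `1` keeps `k` positive when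
  -- `K = 0`.
  filter_upwards [eventually_ge_atTop (2 * K + 1)] with k hk
  obtain ⟨j, rfl⟩ : ∃ j, k = K + j := ⟨k - K, by omega⟩
  have hr := hpos (K + j) (by omega)
  have hk0 : (0 : ℝ) < ((K + j : ℕ) : ℝ) := by exact_mod_cast (by omega : 0 < K + j)
  rw [Real.norm_of_nonneg (Real.rpow_nonneg hr.le _),
    Real.norm_of_nonneg (Real.rpow_nonneg hk0.le _), ← Real.mul_rpow (by positivity) hk0.le]
  have h1 : p * β / 2 * ((K + j : ℕ) : ℝ) ≤ r (K + j) ^ (-p) := by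
    refine le_trans ?_ (hlin j)
    have : ((K + j : ℕ) : ℝ) ≤ 2 * j := by exact_mod_cast (by omega : K + j ≤ 2 * j)
    have hpb : 0 ≤ p * β / 2 := by positivity
    nlinarith
  have h2 : r (K + j) ^ (1 - q) = (r (K + j) ^ (-p)) ^ (-((1 - q) / p)) := by
    rw [← Real.rpow_mul hr.le]
    congr 1
    field_simp
  rw [h2]
  refine Real.rpow_le_rpow_of_nonpos (by positivity) h1 ?_
  rw [neg_nonpos]
  exact div_nonneg (by linarith) hp0.le

end Recursion

/-! ### Descent sequences under the KL property -/

section Descent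

variable {F : Type*} [NormedAddCommGroup F] [InnerProductSpace ℝ F] [CompleteSpace F]

/-- A gradient descent sequence, started at the index `1`: sufficient decrease of `f`, and gradients
bounded by the steps. -/
structure IsDescent (f : F → ℝ) (y : ℕ → F) (κ γ : ℝ) : Prop where
  kappa_pos : 0 < κ
  gamma_pos : 0 < γ
  step_ne : ∀ k, 1 ≤ k → y (k + 1) ≠ y k
  decrease : ∀ k, 1 ≤ k → f (y (k + 1)) ≤ f (y k) - κ * ‖y (k + 1) - y k‖ ^ 2
  gradient_le : ∀ k, 1 ≤ k → ‖gradient f (y k)‖ ≤ γ * ‖y (k + 1) - y k‖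

namespace IsDescent

variable {f : F → ℝ} {y : ℕ → F} {κ γ : ℝ} {yb : F}

lemma lt (hd : IsDescent f y κ γ) {k : ℕ} (hk : 1 ≤ k) : f (y (k + 1)) < f (y k) := by
  have h1 := hd.decrease k hk
  have h2 := norm_pos_iff.2 (sub_ne_zero.2 (hd.step_ne k hk))
  have h3 := hd.kappa_pos
  have : 0 < κ * ‖y (k + 1) - y k‖ ^ 2 := by positivity
  linarith

lemma antitone (hd : IsDescent f y κ γ) : Antitone fun k => f (y (k + 1)) :=
  antitone_nat_of_succ_le fun k => (hd.lt (by omega)).le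

lemma tendsto_value (hd : IsDescent f y κ γ) (hf : Continuous f) (hyb : MapClusterPt yb atTop y) :
    Tendsto (fun k => f (y k)) atTop (𝓝 (f yb)) := by
  obtain ⟨φ, hφ, hlim⟩ := hyb.tendsto_subseq
  have hsub : Tendsto (fun j => f (y (φ j))) atTop (𝓝 (f yb)) := (hf.tendsto yb).comp hlim
  rw [← tendsto_add_atTop_iff_nat 1]
  -- Index `0` carries no information, so monotonicity holds for the shifted sequence only; `φ (j +
  -- 1) ≥ 1` makes the shift invertible.
  have hφ' : Tendsto (fun j => φ (j + 1) - 1) atTop atTop :=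
    (tendsto_sub_atTop_nat 1).comp (hφ.tendsto_atTop.comp (tendsto_add_atTop_nat 1))
  rw [tendsto_iff_tendsto_subseq_of_antitone hd.antitone hφ']
  refine (hsub.comp (tendsto_add_atTop_nat 1)).congr fun j => ?_
  have := hφ.le_apply (x := j + 1)
  simp only [Function.comp]
  rw [Nat.sub_add_cancel (by omega)]

lemma value_lt (hd : IsDescent f y κ γ) (hf : Continuous f) (hyb : MapClusterPt yb atTop y) {k : ℕ}
    (hk : 1 ≤ k) : f yb < f (y k) := by
  refine lt_of_le_of_lt ?_ (hd.lt hk)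
  have := (tendsto_add_atTop_iff_nat 1).2 (hd.tendsto_value hf hyb)
  exact hd.antitone.le_of_tendsto this k

lemma tendsto_step (hd : IsDescent f y κ γ) (hf : Continuous f) (hyb : MapClusterPt yb atTop y) :
    Tendsto (fun k => ‖y (k + 1) - y k‖) atTop (𝓝 0) := by
  have h := hd.tendsto_value hf hyb
  have h1 := ((h.sub ((tendsto_add_atTop_iff_nat 1).2 h)).const_mul (1 / κ)).sqrt
  rw [sub_self, mul_zero, Real.sqrt_zero] at h1
  refine squeeze_zero' (Eventually.of_forall fun _ => norm_nonneg _) ?_ h1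
  filter_upwards [eventually_ge_atTop 1] with k hk
  apply Real.le_sqrt_of_sq_le
  have hκ := hd.kappa_pos
  rw [one_div, le_inv_mul_iff₀ hκ]
  linarith [hd.decrease k hk]

/-- Under the KL property the tail of the sequence is controlled by the desingularizing function. -/
lemma exists_norm_sub_le (hd : IsDescent f y κ γ) (hf : Continuous f)
    (hyb : MapClusterPt yb atTop y) {ψ : ℝ → ℝ} (hKL : KLWith f yb ψ) :
    Tendsto y atTop (𝓝 yb) ∧ ∃ K, 1 ≤ K ∧ ∀ k, K ≤ k →
      f (y k) - f yb ≤ 1 ∧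
      ψ (f (y k) - f yb) ≤ ‖gradient f (y k)‖ ∧
      ‖y k - yb‖ ≤ γ / κ * desing ψ (f (y k) - f yb) := by
  obtain ⟨η, hη, U, hU, hpos, hmono, hint, hineq⟩ := hKL
  obtain ⟨ρ, hρ, hball⟩ := Metric.mem_nhds_iff.1 hU
  have hκ := hd.kappa_pos
  have hγ := hd.gamma_pos
  set r : ℕ → ℝ := fun k => f (y k) - f yb with hr
  have hr0 : ∀ k, 1 ≤ k → 0 < r k := fun k hk => sub_pos.2 (hd.value_lt hf hyb hk)
  have hrlim : Tendsto r atTop (𝓝 0) := by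
    simpa [hr] using (hd.tendsto_value hf hyb).sub_const (f yb)
  have hrlim' : Tendsto r atTop (𝓝[>] 0) :=
    tendsto_nhdsWithin_iff.2 ⟨hrlim, by
      filter_upwards [eventually_ge_atTop 1] with k hk using hr0 k hk⟩
  have hΦlim : Tendsto (fun k => γ / κ * desing ψ (r k)) atTop (𝓝 0) := by
    simpa using ((tendsto_desing hη hint).comp hrlim').const_mul (γ / κ)
  have hKLk : ∀ k, 1 ≤ k → r k < η → y k ∈ Metric.ball yb ρ →
      ψ (r k) ≤ ‖gradient f (y k)‖ := fun k hk hkη hkb =>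
    hineq (y k) (hball hkb) (hd.value_lt hf hyb hk) (by simp only [hr] at hkη; linarith)
  -- Dividing the decrease by `ψ (r k) ≤ γ * ‖y (k + 1) - y k‖` leaves one power of the step,
  -- bounded by a telescoping difference.
  have hstep : ∀ k, 1 ≤ k → r k < η → y k ∈ Metric.ball yb ρ →
      ‖y (k + 1) - y k‖ ≤ γ / κ * desing ψ (r k) - γ / κ * desing ψ (r (k + 1)) := by
    intro k hk hkη hkb
    have h1 := hKLk k hk hkη hkb
    have hψ := hpos _ ⟨hr0 k hk, hkη⟩
    have hΔ := norm_pos_iff.2 (sub_ne_zero.2 (hd.step_ne k hk))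
    have h2 := div_le_desing_sub hpos hmono hint (hr0 (k + 1) (by omega))
      (by simp only [hr]; linarith [hd.lt hk]) hkη
    have h3 : κ * ‖y (k + 1) - y k‖ ^ 2 ≤ r k - r (k + 1) := by
      simp only [hr]; linarith [hd.decrease k hk]
    have h4 : κ / γ * ‖y (k + 1) - y k‖ ≤ (r k - r (k + 1)) / ψ (r k) := by
      rw [le_div_iff₀ hψ]
      calc _ ≤ κ / γ * ‖y (k + 1) - y k‖ * (γ * ‖y (k + 1) - y k‖) := by
            gcongr
            exact h1.trans (hd.gradient_le k hk)
        _ = κ * ‖y (k + 1) - y k‖ ^ 2 := by field_simp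
        _ ≤ _ := h3
    calc ‖y (k + 1) - y k‖ = γ / κ * (κ / γ * ‖y (k + 1) - y k‖) := by field_simp
      _ ≤ γ / κ * (desing ψ (r k) - desing ψ (r (k + 1))) := by gcongr; exact h4.trans h2
      _ = _ := by ring
  -- Start within `δ / 2` of `yb` with less than `δ / 2` of total length remaining: by induction the
  -- iterates never leave the ball in which the KL inequality holds.
  have htrap : ∀ δ, 0 < δ → δ ≤ ρ → ∃ K, 1 ≤ K ∧ ∀ k, K ≤ k → r k < η ∧ ‖y k - yb‖ < δ := by
    intro δ hδ hδρ
    have hev := ((hΦlim.eventually_lt_const (half_pos hδ)).and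
      (hrlim.eventually_lt_const hη)).and (eventually_ge_atTop 1)
    obtain ⟨K0, hK0⟩ := eventually_atTop.1 hev
    obtain ⟨K, hKK, hyK⟩ := frequently_atTop.1
      (hyb.frequently (Metric.ball_mem_nhds yb (half_pos hδ))) K0
    rw [dist_eq_norm] at hyK
    have hind : ∀ k, K ≤ k →
        ‖y k - yb‖ ≤ ‖y K - yb‖ + (γ / κ * desing ψ (r K) - γ / κ * desing ψ (r k)) ∧
          ‖y k - yb‖ < δ := by
      have hlt : ∀ k, K ≤ k →
          ‖y k - yb‖ ≤ ‖y K - yb‖ + (γ / κ * desing ψ (r K) - γ / κ * desing ψ (r k)) →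
          ‖y k - yb‖ < δ := fun k hk hle => by
        have h1 := (hK0 K hKK).1.1
        have h2 : 0 ≤ γ / κ * desing ψ (r k) := mul_nonneg (by positivity)
          (desing_nonneg hpos (hr0 k (hK0 k (by omega)).2).le (hK0 k (by omega)).1.2)
        linarith
      intro k hk
      induction k, hk using Nat.le_induction with
      | base => exact ⟨by simp, hlt K le_rfl (by simp)⟩
      | succ k hk ih =>
        have h1 := hstep k (hK0 k (by omega)).2 (hK0 k (by omega)).1.2
          (by rw [Metric.mem_ball, dist_eq_norm]; exact ih.2.trans_le hδρ)
        have h2 : ‖y (k + 1) - yb‖ ≤ ‖y (k + 1) - y k‖ + ‖y k - yb‖ :=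
          norm_sub_le_norm_sub_add_norm_sub _ _ _
        have h3 : ‖y (k + 1) - yb‖ ≤ ‖y K - yb‖ +
            (γ / κ * desing ψ (r K) - γ / κ * desing ψ (r (k + 1))) := by linarith [ih.1]
        exact ⟨h3, hlt _ (by omega) h3⟩
    exact ⟨K, (hK0 K hKK).2, fun k hk => ⟨(hK0 k (by omega)).1.2, (hind k hk).2⟩⟩
  have hconv : Tendsto y atTop (𝓝 yb) := by
    rw [Metric.tendsto_atTop]
    intro δ hδ
    obtain ⟨K, -, hK⟩ := htrap (min δ ρ) (lt_min hδ hρ) (min_le_right _ _)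
    exact ⟨K, fun k hk => by
      rw [dist_eq_norm]; exact (hK k hk).2.trans_le (min_le_left _ _)⟩
  refine ⟨hconv, ?_⟩
  obtain ⟨K1, hK1, hK⟩ := htrap ρ hρ le_rfl
  obtain ⟨K2, hK2⟩ := eventually_atTop.1 (hrlim.eventually_le_const zero_lt_one)
  refine ⟨max K1 K2, le_max_of_le_left hK1, fun k hk => ?_⟩
  have hk1 : K1 ≤ k := (le_max_left _ _).trans hk
  have hb : ∀ k, K1 ≤ k → y k ∈ Metric.ball yb ρ := fun k hk => by
    rw [Metric.mem_ball, dist_eq_norm]; exact (hK k hk).2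
  refine ⟨hK2 k ((le_max_right _ _).trans hk),
    hKLk k (by omega) (hK k hk1).1 (hb k hk1), ?_⟩
  have hfar : ∀ j, k ≤ j →
      ‖y k - y j‖ ≤ γ / κ * desing ψ (r k) - γ / κ * desing ψ (r j) := by
    intro j hj
    induction j, hj using Nat.le_induction with
    | base => simp
    | succ j hj ih =>
      have h1 := hstep j (by omega) (hK j (by omega)).1 (hb j (by omega))
      have h2 := norm_sub_le_norm_sub_add_norm_sub (y k) (y j) (y (j + 1))
      rw [norm_sub_rev (y j)] at h2
      linarith
  refine le_of_tendsto (hconv.const_sub (y k)).norm ?_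
  filter_upwards [eventually_ge_atTop k] with j hj
  have h2 : 0 ≤ γ / κ * desing ψ (r j) := mul_nonneg (by positivity)
    (desing_nonneg hpos (hr0 j (by omega)).le (hK j (by omega)).1)
  linarith [hfar j hj]

end IsDescent

lemma convergesLinearly_of_eventually {E : Type*} [NormedAddCommGroup E] {u : ℕ → E} {l : E} {c ρ : ℝ} (hρ : ρ ∈ Ioo (0 : ℝ) 1)
    (hc : 0 ≤ c) {K : ℕ} (h : ∀ j, ‖u (K + j) - l‖ ≤ c * ρ ^ j) : ConvergesLinearly u l := by
  have hρ0 := hρ.1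
  -- The first summand serves the tail, the sum the finitely many earlier indices, and `1` makes the
  -- constant positive.
  refine ⟨c / ρ ^ K + ∑ k ∈ Finset.range K, ‖u k - l‖ / ρ ^ k + 1, by positivity, ρ, hρ,
    fun k _ => ?_⟩
  rw [← div_le_iff₀ (by positivity)]
  rcases lt_or_ge k K with hk | hk
  · have := Finset.single_le_sum (f := fun k => ‖u k - l‖ / ρ ^ k) (fun _ _ => by positivity)
      (Finset.mem_range.2 hk)
    have h2 : 0 ≤ c / ρ ^ K := by positivity
    linarith
  · obtain ⟨j, rfl⟩ := Nat.exists_eq_add_of_le hk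
    have h1 : ‖u (K + j) - l‖ / ρ ^ (K + j) ≤ c / ρ ^ K := by
      rw [div_le_div_iff₀ (by positivity) (by positivity)]
      calc _ ≤ c * ρ ^ j * ρ ^ K := by gcongr; exact h j
        _ = _ := by ring
    have h2 : 0 ≤ ∑ k ∈ Finset.range K, ‖u k - l‖ / ρ ^ k :=
      Finset.sum_nonneg fun _ _ => by positivity
    linarith

namespace IsDescent

variable {f : F → ℝ} {y : ℕ → F} {κ γ : ℝ} {yb : F}

lemma rates (hd : IsDescent f y κ γ) (hf : Continuous f) (hyb : MapClusterPt yb atTop y)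
    {M q : ℝ} (hM : 0 < M) (hq1 : q < 1) (hKL : KLWith f yb fun t => M * t ^ q) :
    (q ≤ 1 / 2 → ConvergesLinearly y yb) ∧
      (1 / 2 < q → (fun k => ‖y k - yb‖) =O[atTop]
        fun k : ℕ => (k : ℝ) ^ (-((1 - q) / (2 * q - 1)))) := by
  obtain ⟨-, K, hK1, hK⟩ := hd.exists_norm_sub_le hf hyb hKL
  have hκ := hd.kappa_pos
  have hγ := hd.gamma_pos
  set r : ℕ → ℝ := fun k => f (y k) - f yb with hr
  have hpos : ∀ k, K ≤ k → 0 < r k := fun k hk => sub_pos.2 (hd.value_lt hf hyb (hK1.trans hk))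
  -- From squaring `M * r k ^ q ≤ γ * ‖y (k + 1) - y k‖` and inserting it in the decrease.
  set β := κ / γ ^ 2 * M ^ 2 with hβ
  have hβ0 : 0 < β := by positivity
  have hrec : ∀ k, K ≤ k → β * r k ^ (2 * q) ≤ r k - r (k + 1) := fun k hk => by
    have h1 : M * r k ^ q ≤ γ * ‖y (k + 1) - y k‖ :=
      (hK k hk).2.1.trans (hd.gradient_le k (hK1.trans hk))
    have hrq := Real.rpow_nonneg (hpos k hk).le q
    have h2 : (M * r k ^ q) ^ 2 ≤ (γ * ‖y (k + 1) - y k‖) ^ 2 := by gcongr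
    have h3 : r k ^ (2 * q) = (r k ^ q) ^ 2 := by
      rw [mul_comm, Real.rpow_mul (hpos k hk).le, Real.rpow_two]
    calc β * r k ^ (2 * q) = κ / γ ^ 2 * (M * r k ^ q) ^ 2 := by rw [h3, hβ]; ring
      _ ≤ κ / γ ^ 2 * (γ * ‖y (k + 1) - y k‖) ^ 2 := by gcongr
      _ = κ * ‖y (k + 1) - y k‖ ^ 2 := by field_simp
      _ ≤ _ := by simp only [hr]; linarith [hd.decrease k (hK1.trans hk)]
  set B := γ / κ * (1 / (M * (1 - q))) with hB
  have hB0 : 0 ≤ B := by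
    have : 0 < 1 - q := by linarith
    positivity
  have hbound : ∀ k, K ≤ k → ‖y k - yb‖ ≤ B * r k ^ (1 - q) := fun k hk => by
    have := (hK k hk).2.2
    rw [desing_rpow hq1 (hpos k hk).le, ← mul_assoc] at this
    exact this
  constructor
  · intro hq
    obtain ⟨ρ, hρ, hgeo⟩ := geometric_of_recursion hβ0 hq hpos (fun k hk => (hK k hk).1) hrec
    refine convergesLinearly_of_eventually (ρ := ρ ^ (1 - q)) (c := B) (K := K)
      ⟨Real.rpow_pos_of_pos hρ.1 _, Real.rpow_lt_one hρ.1.le hρ.2 (by linarith)⟩ hB0 fun j => ?_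
    refine (hbound _ (by omega)).trans ?_
    rw [← Real.rpow_natCast, ← Real.rpow_mul hρ.1.le, mul_comm (1 - q), Real.rpow_mul hρ.1.le,
      Real.rpow_natCast]
    gcongr
    · exact (hpos _ (by omega)).le
    · exact hgeo j
  · intro hq
    refine IsBigO.trans (IsBigO.of_bound B ?_) (sublinear_of_recursion hβ0 hq hq1 hpos hrec)
    filter_upwards [eventually_ge_atTop K] with k hk
    rw [norm_norm, Real.norm_of_nonneg (Real.rpow_nonneg (hpos k hk).le _)]
    exact hbound k hk

end IsDescent

end Descent

end GIALM

/-! ### The generated sequences, and the theorem -/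

namespace GIALM

variable {m n : ℕ} {h : EuclideanSpace ℝ (Fin n) → EReal} {A : Matrix (Fin m) (Fin n) ℝ}
  {b : EuclideanSpace ℝ (Fin m)} {lam θ μ : ℝ} {x : ℕ → EuclideanSpace ℝ (Fin n)}
  {y : ℕ → EuclideanSpace ℝ (Fin m)} {ε : ℕ → ℝ} {i : ℕ → ℕ}
  {D : EuclideanSpace ℝ (Fin m) → ℝ} {u : EuclideanSpace ℝ (Fin m) → EuclideanSpace ℝ (Fin m)}

lemma exists_forall_isAugMin (h_proper : Proper h) (h_convex : ConvexFun h)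
    (hl : 0 < lam) (h_dual : ⊥ < ⨆ w, dual h A b w) :
    ∃ (D : EuclideanSpace ℝ (Fin m) → ℝ) (u : EuclideanSpace ℝ (Fin m) → EuclideanSpace ℝ (Fin m)),
      ∀ y, IsAugMin (valueEpi h A b) lam y (D y) (u y) := by
  obtain ⟨hb, x₀, hx₀⟩ := h_proper
  obtain ⟨w, hw⟩ := lt_iSup_iff.1 h_dual
  obtain ⟨c, -, hc⟩ := EReal.lt_iff_exists_real_btwn.1 hw
  have hne : (valueEpi h A b).Nonempty :=
    ⟨(mulE A x₀ - b, (h x₀).toReal), x₀, rfl, (EReal.coe_toReal hx₀ (hb x₀)).ge⟩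
  choose D u hDu using exists_isAugMin (convex_valueEpi (A := A) (b := b) h_convex) hne hl
    ((coe_le_dual hb w c).1 hc.le)
  exact ⟨D, u, hDu⟩

namespace IsGenerated

lemma eps_pos (hg : IsGenerated h A b lam θ μ x y ε i) {k : ℕ} (hk : 1 ≤ k) : 0 < ε k := by
  induction k, hk using Nat.le_induction with
  | base => exact hg.eps_one_pos
  | succ k hk ih =>
    rw [hg.eps_update k hk]
    exact mul_pos (pow_pos hg.theta_mem.1 _) ih

lemma eps_lt (hg : IsGenerated h A b lam θ μ x y ε i) {k : ℕ} (hk : 1 ≤ k) :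
    μ * ε (k + 1) < ‖mulE A (x (k + 1)) - b‖ := by
  rw [hg.eps_update k hk, norm_sub_rev]
  exact hg.residual k hk

lemma norm_step (hg : IsGenerated h A b lam θ μ x y ε i) {k : ℕ} (hk : 1 ≤ k) :
    ‖y (k + 1) - y k‖ = lam * ‖mulE A (x (k + 1)) - b‖ := by
  rw [hg.y_update k hk, add_sub_cancel_left, norm_smul, Real.norm_of_nonneg hg.lam_pos.le]

lemma accuracy_real (hg : IsGenerated h A b lam θ μ x y ε i) (hb : ∀ x, h x ≠ ⊥)
    (hm : ∀ y, IsAugMin (valueEpi h A b) lam y (D y) (u y)) {k : ℕ} (hk : 1 ≤ k) :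
    ∃ a : ℝ, h (x (k + 1)) = a ∧ augValue lam (y k) (mulE A (x (k + 1)) - b, a) ≤
      D (y k) + lam / 2 * ε (k + 1) ^ 2 := by
  rw [hg.eps_update k hk]
  exact (hm (y k)).of_accuracyTest hb hg.lam_pos (hg.accuracy k hk)

lemma norm_residual_sub_le (hg : IsGenerated h A b lam θ μ x y ε i) (hb : ∀ x, h x ≠ ⊥)
    (hm : ∀ y, IsAugMin (valueEpi h A b) lam y (D y) (u y)) {k : ℕ} (hk : 1 ≤ k) :
    ‖mulE A (x (k + 1)) - b - u (y k)‖ ≤ ε (k + 1) := by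
  obtain ⟨a, ha, hle⟩ := hg.accuracy_real hb hm hk
  have h1 := (hm (y k)).add_sq_le (p := (mulE A (x (k + 1)) - b, a)) ⟨_, rfl, ha.le⟩
  have hl := hg.lam_pos
  have h2 : lam / 2 * ‖mulE A (x (k + 1)) - b - u (y k)‖ ^ 2 ≤ lam / 2 * ε (k + 1) ^ 2 := by
    simp only at h1
    linarith
  exact (sq_le_sq₀ (norm_nonneg _) (hg.eps_pos (by omega)).le).1
    (le_of_mul_le_mul_left h2 (by positivity))

/-- With `v` the computed residual, the relative error gives `⟨u, v⟩ ≥ (1 - 1 / μ) ‖v‖²`, while the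
quadratic bound on `D` costs `‖v‖² / 2`; a positive decrease remains because `μ > 2`. The same error
bound gives `‖u‖ ≤ 2 ‖v‖`. -/
lemma isDescent (hg : IsGenerated h A b lam θ μ x y ε i) (hb : ∀ x, h x ≠ ⊥)
    (hm : ∀ y, IsAugMin (valueEpi h A b) lam y (D y) (u y)) :
    IsDescent (fun z => -D z) y ((1 / 2 - 1 / μ) / lam) (2 / lam) := by
  have hl := hg.lam_pos
  have hμ := hg.two_lt_mu
  have hμ0 : 0 < μ := by linarith
  have hv : ∀ k, 1 ≤ k → 0 < ‖mulE A (x (k + 1)) - b‖ := fun k hk =>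
    (mul_pos hμ0 (hg.eps_pos (by omega))).trans (hg.eps_lt hk)
  have herr : ∀ k, 1 ≤ k →
      ‖mulE A (x (k + 1)) - b - u (y k)‖ ≤ 1 / μ * ‖mulE A (x (k + 1)) - b‖ := fun k hk => by
    refine (hg.norm_residual_sub_le hb hm hk).trans ?_
    rw [one_div, le_inv_mul_iff₀ hμ0]
    exact (hg.eps_lt hk).le
  have hμ1 : 1 / μ < 1 / 2 := one_div_lt_one_div_of_lt two_pos hμ
  refine ⟨div_pos (by linarith) hl, by positivity, fun k hk heq => ?_, fun k hk => ?_,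
    fun k hk => ?_⟩
  · have := hg.norm_step hk
    rw [heq, sub_self, norm_zero] at this
    have := mul_pos hl (hv k hk)
    linarith
  · have h1 := (hm (y k)).add_inner_le hl (hm (y (k + 1)))
    have hst : y (k + 1) - y k = lam • (mulE A (x (k + 1)) - b) := by
      rw [hg.y_update k hk, add_sub_cancel_left]
    have hns := hg.norm_step hk
    have he := herr k hk
    rw [hns]
    rw [hns, hst, inner_smul_right] at h1
    set v := mulE A (x (k + 1)) - b
    have h2 : inner ℝ (u (y k)) v = ‖v‖ ^ 2 - inner ℝ (v - u (y k)) v := by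
      rw [inner_sub_left, real_inner_self_eq_norm_sq]
      ring
    have h3 : inner ℝ (v - u (y k)) v ≤ 1 / μ * ‖v‖ * ‖v‖ :=
      (real_inner_le_norm _ _).trans (by gcongr)
    have h4 : (1 - 1 / μ) * ‖v‖ ^ 2 ≤ inner ℝ (u (y k)) v := by linarith
    have h5 := mul_le_mul_of_nonneg_left h4 hl.le
    have e1 : (1 / 2 - 1 / μ) / lam * (lam * ‖v‖) ^ 2 = lam * (1 / 2 - 1 / μ) * ‖v‖ ^ 2 := by
      field_simp
    have e2 : 1 / (2 * lam) * (lam * ‖v‖) ^ 2 = lam / 2 * ‖v‖ ^ 2 := by field_simp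
    rw [e1]
    rw [e2] at h1
    linarith
  · rw [(hasGradientAt_neg_of_isAugMin hl hm (y k)).gradient, norm_neg, hg.norm_step hk,
      ← mul_assoc, div_mul_cancel₀ _ hl.ne']
    have h1 := norm_sub_norm_le (u (y k)) (mulE A (x (k + 1)) - b)
    rw [norm_sub_rev (u (y k))] at h1
    have h2 : 1 / μ * ‖mulE A (x (k + 1)) - b‖ ≤ 1 / 2 * ‖mulE A (x (k + 1)) - b‖ := by gcongr
    linarith [herr k hk, hv k hk]

/-- An upper bound of the augmented dual values bounds `h` at accumulation points. -/
lemma le_of_mapClusterPt (hg : IsGenerated h A b lam θ μ x y ε i) (hb : ∀ x, h x ≠ ⊥)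
    (h_lsc : LowerSemicontinuous h) (hm : ∀ y, IsAugMin (valueEpi h A b) lam y (D y) (u y))
    (hbdd : Bornology.IsBounded (range y))
    (hres : Tendsto (fun k => ‖mulE A (x (k + 1)) - b‖) atTop (𝓝 0))
    {xb : EuclideanSpace ℝ (Fin n)} (hxb : MapClusterPt xb atTop x) {c : ℝ}
    (hc : ∀ k, D (y k) ≤ c) : h xb ≤ c := by
  by_contra! hlt
  obtain ⟨c', h1, h2⟩ := EReal.lt_iff_exists_real_btwn.1 hlt
  have hcc : c < c' := by exact_mod_cast h1
  obtain ⟨R, hR⟩ := hbdd.exists_norm_le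
  have hl := hg.lam_pos
  -- The majorant of `h (x (k + 1))`: accuracy error at most `lam / 2 * ‖v‖ ^ 2`, multiplier term at
  -- most `R * ‖v‖`, where `v` is the residual.
  have hlim : Tendsto (fun k => c + lam / 2 * ‖mulE A (x (k + 1)) - b‖ ^ 2
      + R * ‖mulE A (x (k + 1)) - b‖) atTop (𝓝 c) := by
    simpa using (((hres.pow 2).const_mul (lam / 2)).const_add c).add (hres.const_mul R)
  have hev : ∀ᶠ k in atTop, h (x k) < c' := by
    rw [← map_add_atTop_eq_nat 1, eventually_map]
    filter_upwards [hlim.eventually_lt_const hcc, eventually_ge_atTop 1] with k hk hk1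
    obtain ⟨a, ha, hle⟩ := hg.accuracy_real hb hm hk1
    rw [ha, EReal.coe_lt_coe_iff]
    have h3 : ε (k + 1) ^ 2 ≤ ‖mulE A (x (k + 1)) - b‖ ^ 2 := by
      have h4 := hg.eps_pos (k := k + 1) (by omega)
      have h5 := hg.eps_lt hk1
      have h6 := hg.two_lt_mu
      have h7 : ε (k + 1) ≤ ‖mulE A (x (k + 1)) - b‖ := by nlinarith
      gcongr
    have h3' := mul_le_mul_of_nonneg_left h3 (half_pos hl).le
    have h8 : -(R * ‖mulE A (x (k + 1)) - b‖) ≤ inner ℝ (y k) (mulE A (x (k + 1)) - b) := by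
      refine le_trans ?_ (neg_le_of_abs_le (abs_real_inner_le_norm _ _))
      have := hR (y k) ⟨k, rfl⟩
      gcongr
    have h9 : 0 ≤ lam / 2 * ‖mulE A (x (k + 1)) - b‖ ^ 2 := by positivity
    have := hc k
    unfold augValue at hle
    simp only at hle
    linarith
  have hfreq := hxb.frequently (h_lsc xb c' h2)
  obtain ⟨k, hk1, hk2⟩ := (hfreq.and_eventually hev).exists
  exact lt_asymm hk1 hk2

end IsGenerated

end GIALM

theorem mainTheorem4 {m n : ℕ} (h : EuclideanSpace ℝ (Fin n) → EReal)
    (A : Matrix (Fin m) (Fin n) ℝ) (b : EuclideanSpace ℝ (Fin m))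
    (h_proper : GIALM.Proper h) (h_lsc : LowerSemicontinuous h) (h_convex : GIALM.ConvexFun h)
    (h_feasible : ∃ x : EuclideanSpace ℝ (Fin n), GIALM.mulE A x = b)
    (lam θ μ : ℝ) (x : ℕ → EuclideanSpace ℝ (Fin n)) (y : ℕ → EuclideanSpace ℝ (Fin m))
    (ε : ℕ → ℝ) (i : ℕ → ℕ)
    (h_gen : GIALM.IsGenerated h A b lam θ μ x y ε i)
    (h_dual : ⊥ < ⨆ w : EuclideanSpace ℝ (Fin m), GIALM.dual h A b w)
    (h_nonsol : ∀ k, 1 ≤ k → ¬ GIALM.IsDualSolution h A b (y k)) :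
    Tendsto (fun k => ‖y k‖) atTop atTop ∨
      (((∀ yb, MapClusterPt yb atTop y → GIALM.IsDualSolution h A b yb) ∧
          (Bornology.IsBounded (range y) →
            ∀ xb, MapClusterPt xb atTop x → GIALM.IsPrimalSolution h A b xb)) ∧
        (∀ yb, MapClusterPt yb atTop y →
          GIALM.KL (GIALM.moreau lam (fun w => -GIALM.dual h A b w)) yb →
            Tendsto y atTop (𝓝 yb)) ∧
        (∀ yb, MapClusterPt yb atTop y → ∀ M q : ℝ, 0 < M → 0 < q → q < 1 →
          GIALM.KLWith (GIALM.moreau lam (fun w => -GIALM.dual h A b w)) yb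
            (fun t => M * t ^ q) →
            (q ≤ 1 / 2 → GIALM.ConvergesLinearly y yb) ∧
            (1 / 2 < q →
              (fun k => ‖y k - yb‖) =O[atTop]
                (fun k : ℕ => (k : ℝ) ^ (-((1 - q) / (2 * q - 1))))))) := by
  have hb := h_proper.1
  have hl := h_gen.lam_pos
  obtain ⟨D, u, hm⟩ := GIALM.exists_forall_isAugMin h_proper h_convex hl h_dual
  have hd := h_gen.isDescent hb hm
  have hgrad := GIALM.hasGradientAt_neg_of_isAugMin hl hm
  have hf : Continuous fun z => -D z :=
    continuous_iff_continuousAt.2 fun z => (hgrad z).differentiableAt.continuousAt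
  have hmor : GIALM.moreau lam (fun w => -GIALM.dual h A b w) = fun z => -D z :=
    funext fun z => (hm z).moreau_eq hb hl
  -- accumulation points maximize the augmented dual function
  have hmax : ∀ yb, MapClusterPt yb atTop y → ∀ z, D z ≤ D yb := by
    intro yb hyb z
    obtain ⟨φ, hφ, hlim⟩ := hyb.tendsto_subseq
    have hu : Tendsto (fun j => u (y (φ j))) atTop (𝓝 0) := by
      have h1 := ((hd.tendsto_step hf hyb).const_mul (2 / lam)).comp hφ.tendsto_atTop
      rw [mul_zero] at h1
      refine squeeze_zero_norm' ?_ h1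
      filter_upwards [hφ.tendsto_atTop.eventually_ge_atTop 1] with j hj
      have h2 := hd.gradient_le (φ j) hj
      rwa [(hgrad _).gradient, norm_neg] at h2
    have hDlim : Tendsto (fun j => D (y (φ j)) + inner ℝ (u (y (φ j))) (z - y (φ j))) atTop
        (𝓝 (D yb + inner ℝ 0 (z - yb))) := by
      have hD : Continuous D := continuous_neg_iff.1 hf
      exact ((hD.tendsto yb).comp hlim).add (hu.inner (hlim.const_sub z))
    rw [inner_zero_left, add_zero] at hDlim
    exact ge_of_tendsto' hDlim fun j => (hm _).le_add_inner hl (hm z)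
  -- The second alternative holds in every case: its claims concern accumulation points of `y` or a
  -- bounded `y`, which has one.
  refine Or.inr ⟨⟨fun yb hyb => GIALM.isDualSolution_of_forall_le hb hl hm (hmax yb hyb),
    fun hbdd xb hxb => ?_⟩, fun yb hyb => ?_, fun yb hyb M q hM _ hq1 hKL => ?_⟩
  · obtain ⟨yb, -, φ, hφ, hlim⟩ := tendsto_subseq_of_bounded hbdd fun k => mem_range_self k
    have hyb : MapClusterPt yb atTop y := hlim.mapClusterPt.of_comp hφ.tendsto_atTop
    have hres : Tendsto (fun k => ‖GIALM.mulE A (x (k + 1)) - b‖) atTop (𝓝 0) := by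
      have h1 := (hd.tendsto_step hf hyb).const_mul (1 / lam)
      rw [mul_zero] at h1
      refine h1.congr' ?_
      filter_upwards [eventually_ge_atTop 1] with k hk
      rw [h_gen.norm_step hk, ← mul_assoc, one_div_mul_cancel hl.ne', one_mul]
    -- Used twice: `c = D yb` gives finiteness of `h xb`, and `c = h z` for feasible `z` gives
    -- optimality.
    have hle : ∀ c : ℝ, (∀ k, D (y k) ≤ c) → h xb ≤ c := fun c =>
      h_gen.le_of_mapClusterPt hb h_lsc hm hbdd hres hxb
    refine ⟨?_, ?_, fun z hz => ?_⟩
    · obtain ⟨φ', hφ', hlim'⟩ := hxb.tendsto_subseq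
      have h1 : Tendsto (fun j => ‖GIALM.mulE A (x (φ' j)) - b‖) atTop (𝓝 0) :=
        ((tendsto_add_atTop_iff_nat (f := fun k => ‖GIALM.mulE A (x k) - b‖) 1).1 hres).comp
          hφ'.tendsto_atTop
      have h2 := (((GIALM.continuous_mulE (A := A)).tendsto xb).comp hlim').sub_const b |>.norm
      have h3 := tendsto_nhds_unique h1 h2
      exact sub_eq_zero.1 (norm_eq_zero.1 h3.symm)
    · exact ((hle (D yb) fun k => hmax yb hyb _).trans_lt (EReal.coe_lt_top _)).ne
    · have hz' := hb z
      induction hv : h z with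
      | bot => exact absurd hv hz'
      | top => exact le_top
      | coe a =>
        refine hle a fun k => ?_
        -- Weak duality: at a feasible `z` the multiplier and penalty terms vanish.
        have h1 := (hm (y k)).le_augValue hl (p := (0, a)) ⟨z, by simp [hz], hv.le⟩
        simpa [GIALM.augValue] using h1
  · rintro ⟨ψ, hKL⟩
    rw [hmor] at hKL
    exact (hd.exists_norm_sub_le hf hyb hKL).1
  · rw [hmor] at hKL
    exact hd.rates hf hyb hM hq1 hKL
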